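/- **Theorem (Digraph placement is universal).** Consider partisan combinatorial games under normal play: two players, Left and Right, alternate turns, and a player who cannot move on their turn loses. A game $X$ is determined by its Left options (the games Left can move to) and its Right options (the games Right can move to); it is *short* if there is an integer $k$ such that every sequence of moves from $X$ (not necessarily alternating) has length at most $k$, and in every position reachable from $X$ each player has only finitely many moves. The disjunctive sum $X+Y$ is the game in which the player to move chooses one of $X$ and $Y$ and makes a move in it. The outcome of a game is *Left win* (Left wins moving first or second), *Right win* (Right wins moving first or second), *next player win* (whoever moves first wins) or *previous player win* (whoever moves second wins). Two games $Y$ and $Z$ are *equal*, $Y=Z$, if for every short game $X$ the games $X+Y$ and $X+Z$ have the same outcome. Let $G=(V,E)$ be a finite (possibly empty) directed graph without loops, in which pairs of opposite edges are allowed, and let $\phi\colon V\to\{\text{blue},\text{red}\}$ be a not necessarily proper $2$-colouring. In the *Digraph placement* game on $(G,\phi)$, Left on her turn chooses a blue vertex that has not been deleted, Right on his turn chooses a red vertex that has not been deleted, and the chosen vertex is deleted together with all of its out-neighbours. For every short game $X$ there exist a finite loopless digraph $G$ and a $2$-colouring $\phi$ of its vertices such that the Digraph placement game on $(G,\phi)$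 is equal to $X$. -/

import Mathlib

universe u

/-- The two players. -/
inductive Player : Type
  | left
  | right

/-- The other player. -/
def Player.opponent : Player → Player
  | .left => .right
  | .right => .left

/-- The four possible outcomes of a normal-play game. -/
inductive Outcome : Type
  | leftWin
  | rightWin
  | nextPlayerWin
  | previousPlayerWin

/-- Partisan combinatorial games: a game is given by the family `L` of its Left options and the
family `R` of its Right options, which are again games. -/
inductive PGame : Type (u + 1)
  | mk (α β : Type u) (L : α → PGame) (R : β → PGame) : PGame

namespace PGame

/-- The index type of the moves of player `p` in the given game. -/
def Moves : Player → PGame.{u} → Type u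
  | .left, mk α _ _ _ => α
  | .right, mk _ β _ _ => β

/-- The game that results from a move of player `p`. -/
def move : (p : Player) → (X : PGame.{u}) → Moves p X → PGame.{u}
  | .left, mk _ _ L _ => L
  | .right, mk _ _ _ R => R

/-- `IsOption Y X`: the game `Y` is a Left option or a Right option of `X`. -/
def IsOption (Y X : PGame.{u}) : Prop :=
  ∃ (p : Player) (i : Moves p X), Y = move p X i

/-- `IsFollower Y X`: the game `Y` is reached from `X` by a finite (possibly empty) sequence of
moves, not necessarily alternating between the players. -/
def IsFollower (Y X : PGame.{u}) : Prop :=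
  Relation.ReflTransGen (fun A B : PGame.{u} => IsOption B A) X Y

/-- Every play of `X` is over after at most `k` moves, whatever the choices made. -/
def EndsWithin : ℕ → PGame.{u} → Prop
  | 0, X => ∀ Y, ¬ IsOption Y X
  | k + 1, X => ∀ Y, IsOption Y X → EndsWithin k Y

/-- A game is short if the length of its plays is bounded by some integer `k`, and at every point
of the game each player has only finitely many moves. -/
def IsShort (X : PGame.{u}) : Prop :=
  (∃ k : ℕ, EndsWithin k X) ∧ ∀ Y, IsFollower Y X → ∀ p : Player, Finite (Moves p Y)

/-- The disjunctive sum `{X^L + Y, X + Y^L | X^R + Y, X + Y^R}`. -/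
noncomputable def add (X : PGame.{u}) : PGame.{u} → PGame.{u} :=
  PGame.rec (motive := fun _ => PGame.{u} → PGame.{u})
    (fun α β _ _ addL addR Y =>
      PGame.rec (motive := fun _ => PGame.{u})
        (fun α' β' L' R' addL' addR' =>
          mk (α ⊕ α') (β ⊕ β')
            (Sum.elim (fun i => addL i (mk α' β' L' R')) addL')
            (Sum.elim (fun j => addR j (mk α' β' L' R')) addR'))
        Y)
    X

noncomputable instance : Add PGame.{u} := ⟨add⟩

theorem mk_add_mk {α β α' β' : Type u} (L : α → PGame.{u}) (R : β → PGame.{u})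
    (L' : α' → PGame.{u}) (R' : β' → PGame.{u}) :
    mk α β L R + mk α' β' L' R' =
      mk (α ⊕ α') (β ⊕ β')
        (Sum.elim (fun i => L i + mk α' β' L' R') (fun i => mk α β L R + L' i))
        (Sum.elim (fun j => R j + mk α' β' L' R') (fun j => mk α β L R + R' j)) :=
  rfl

mutual

/-- Under normal play, player `p` wins moving first iff `p` has a move after which `p` wins
as the player who moves second. In particular a player who cannot move loses. -/
def WinsFirst : PGame.{u} → Player → Prop
  | mk α _ L _, .left => ∃ i : α, WinsSecond (L i) .left
  | mk _ β _ R, .right => ∃ j : β, WinsSecond (R j) .right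

/-- Player `p` wins moving second iff `p` wins moving first after every move of the opponent. -/
def WinsSecond : PGame.{u} → Player → Prop
  | mk _ β _ R, .left => ∀ j : β, WinsFirst (R j) .left
  | mk α _ L _, .right => ∀ i : α, WinsFirst (L i) .right

end

/-- `X.HasOutcome o`: the outcome of `X` is `o`. -/
def HasOutcome (X : PGame.{u}) : Outcome → Prop
  | .leftWin => X.WinsFirst .left ∧ X.WinsSecond .left
  | .rightWin => X.WinsFirst .right ∧ X.WinsSecond .right
  | .nextPlayerWin => X.WinsFirst .left ∧ X.WinsFirst .right
  | .previousPlayerWin => X.WinsSecond .left ∧ X.WinsSecond .right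

/-- Equality of games: `Y = Z` iff `X + Y` and `X + Z` have the same outcome for every
short game `X`. -/
def Equal (Y Z : PGame.{u}) : Prop :=
  ∀ X : PGame.{u}, X.IsShort → ∀ o : Outcome, (X + Y).HasOutcome o ↔ (X + Z).HasOutcome o

end PGame

/-- The colours of vertices; Left plays the blue vertices and Right the red ones. -/
inductive Color : Type
  | blue
  | red

namespace DigraphPlacement

open Classical in
/-- The vertices that remain of `S` after `v` and all its out-neighbours are deleted. -/
noncomputable def delete {V : Type u} (G : Digraph V) (S : Finset V) (v : V) : Finset V :=
  S.filter fun w => w ≠ v ∧ ¬ G.Adj v w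

theorem card_delete_lt {V : Type u} (G : Digraph V) {S : Finset V} {v : V} (hv : v ∈ S) :
    (delete G S v).card < S.card := by
  classical
  refine Finset.card_lt_card (Finset.ssubset_iff_subset_ne.mpr ⟨Finset.filter_subset _ _, ?_⟩)
  intro h
  have h' : v ∈ delete G S v := by rw [h]; exact hv
  simp [delete] at h'

/-- The Digraph placement position in which exactly the vertices of `S` have not been deleted:
Left may choose any blue vertex of `S`, Right any red one, and the chosen vertex is deleted
together with its out-neighbours. -/
noncomputable def position {V : Type u} (G : Digraph V) (φ : V → Color) (S : Finset V) :
    PGame.{u} :=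
  PGame.mk {v : V // v ∈ S ∧ φ v = Color.blue} {v : V // v ∈ S ∧ φ v = Color.red}
    (fun v => position G φ (delete G S v.1))
    (fun v => position G φ (delete G S v.1))
termination_by S.card
decreasing_by
  · exact card_delete_lt G v.2.1
  · exact card_delete_lt G v.2.1

/-- The Digraph placement game played on the finite digraph `G` with 2-colouring `φ` (not
necessarily proper). -/
noncomputable def game {V : Type u} [Fintype V] (G : Digraph V) (φ : V → Color) : PGame.{u} :=
  position G φ Finset.univ

end DigraphPlacement

-- Build the digraph recursively from digraphs for the options of X. Take a disjoint copy of each of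
-- these, plus one key vertex per option, in the colour of its owner, that deletes everything but
-- its copy. Playing a key thus moves to that option. Every other first move must be made useless,
-- and the guards do this. Their four classes form a cycle with alternating colours; a guard spares
-- only its own class and the next one, while an inner vertex spares no guards but one class of the
-- other colour. After a first move on a guard or an inner vertex, the other player answers with a
-- guard and is left with at least k free moves of his own and nothing else, where k bounds the
-- length of X. This is at least as good for him as X (`pref_position_of_independent`), so only the
-- keys matter. `Pref.of_moves` turns this into a comparison with X, for each player separately.

/-- The colour of the vertices that a player may choose. -/
def Player.color : Player → Color
  | .left => .blue
  | .right => .red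

theorem Player.opponent_opponent (p : Player) : p.opponent.opponent = p := by
  cases p <;> rfl

theorem Player.color_injective : Function.Injective Player.color := by
  intro p q h
  cases p <;> cases q <;> simp_all [Player.color]

instance : Finite Player :=
  Finite.of_surjective (fun b : Bool => if b then Player.left else Player.right) fun p => by
    cases p <;> simp

theorem Player.opponent_ne (p : Player) : p.opponent ≠ p := by
  cases p <;> simp [Player.opponent]

-- Comparison of games in arbitrary contexts

namespace PGame

theorem winsFirst_iff (X : PGame.{u}) (p : Player) :
    X.WinsFirst p ↔ ∃ i : Moves p X, (move p X i).WinsSecond p := by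
  cases X; cases p <;> rw [WinsFirst] <;> rfl

theorem winsSecond_iff (X : PGame.{u}) (p : Player) :
    X.WinsSecond p ↔ ∀ i : Moves p.opponent X, (move p.opponent X i).WinsFirst p := by
  cases X; cases p <;> rw [WinsSecond] <;> rfl

theorem exists_move_add {p : Player} {X Y : PGame.{u}} {P : PGame.{u} → Prop} :
    (∃ i : Moves p (X + Y), P (move p (X + Y) i)) ↔
      (∃ i : Moves p X, P (move p X i + Y)) ∨ ∃ i : Moves p Y, P (X + move p Y i) := by
  cases X; cases Y; cases p <;> exact Sum.exists

theorem forall_move_add {p : Player} {X Y : PGame.{u}} {P : PGame.{u} → Prop} :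
    (∀ i : Moves p (X + Y), P (move p (X + Y) i)) ↔
      (∀ i : Moves p X, P (move p X i + Y)) ∧ ∀ i : Moves p Y, P (X + move p Y i) := by
  cases X; cases Y; cases p <;> exact Sum.forall

theorem move_induction {P : PGame.{u} → Prop}
    (h : ∀ X, (∀ (p : Player) (i : Moves p X), P (move p X i)) → P X) (X : PGame.{u}) : P X := by
  induction X with
  | mk α β L R ihL ihR =>
    refine h _ fun p => ?_
    cases p
    · exact ihL
    · exact ihR

/-- Exactly one of the two players has a winning strategy when `p` moves first. -/
theorem not_winsFirst_and_not_winsSecond (X : PGame.{u}) :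
    ∀ p : Player, (¬ X.WinsFirst p ↔ X.WinsSecond p.opponent) ∧
      (¬ X.WinsSecond p ↔ X.WinsFirst p.opponent) := by
  induction X using move_induction with
  | h X ih =>
    intro p
    constructor
    · rw [winsFirst_iff, winsSecond_iff, Player.opponent_opponent, not_exists]
      exact forall_congr' fun i => (ih p i p).2
    · rw [winsFirst_iff, winsSecond_iff, not_forall]
      exact exists_congr fun i => (ih _ i p).1

theorem not_winsFirst {X : PGame.{u}} {p : Player} :
    ¬ X.WinsFirst p ↔ X.WinsSecond p.opponent :=
  (not_winsFirst_and_not_winsSecond X p).1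

theorem not_winsSecond {X : PGame.{u}} {p : Player} :
    ¬ X.WinsSecond p ↔ X.WinsFirst p.opponent :=
  (not_winsFirst_and_not_winsSecond X p).2

/-- In every context, the game `Z` is at least as good for `p` as the game `Y`. -/
def Pref (p : Player) (Y Z : PGame.{u}) : Prop :=
  ∀ W : PGame.{u}, ((W + Y).WinsSecond p → (W + Z).WinsSecond p) ∧
    ((W + Y).WinsFirst p → (W + Z).WinsFirst p)

/-- In every context, the game `Z` with `p` to move is at least as good for `p` as the game `Y`
with the opponent to move. -/
def PrefFirst (p : Player) (Y Z : PGame.{u}) : Prop :=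
  ∀ W : PGame.{u}, (W + Y).WinsSecond p → (W + Z).WinsFirst p

theorem Pref.trans {p : Player} {X Y Z : PGame.{u}} (h₁ : Pref p X Y) (h₂ : Pref p Y Z) :
    Pref p X Z :=
  fun W => ⟨fun h => (h₂ W).1 ((h₁ W).1 h), fun h => (h₂ W).2 ((h₁ W).2 h)⟩

/-- By determinacy, this is the contrapositive in each context. -/
theorem Pref.opponent {p : Player} {Y Z : PGame.{u}} (h : Pref p Y Z) :
    Pref p.opponent Z Y := by
  intro W
  rw [← not_winsFirst, ← not_winsFirst, ← not_winsSecond, ← not_winsSecond]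
  exact ⟨mt (h W).2, mt (h W).1⟩

theorem PrefFirst.of_move {p : Player} {Y Z : PGame.{u}}
    (h : ∃ i : Moves p Z, Pref p Y (move p Z i)) : PrefFirst p Y Z := by
  obtain ⟨i, hi⟩ := h
  intro W hW
  rw [winsFirst_iff]
  exact exists_move_add (P := fun A => A.WinsSecond p) |>.2 (Or.inr ⟨i, (hi W).1 hW⟩)

theorem PrefFirst.of_move_opponent {p : Player} {Y Z : PGame.{u}}
    (h : ∃ i : Moves p.opponent Y, Pref p (move p.opponent Y i) Z) : PrefFirst p Y Z := by
  obtain ⟨i, hi⟩ := h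
  intro W hW
  rw [winsSecond_iff] at hW
  exact (hi W).2 ((forall_move_add (P := fun A => A.WinsFirst p) |>.1 hW).2 i)

/-- Strategy transfer by induction on the context: a move in `W` leaves the pair `Y`, `Z` unchanged,
and the first move outside `W` is covered by the hypotheses. -/
theorem Pref.of_moves {p : Player} {Y Z : PGame.{u}}
    (h₁ : ∀ i : Moves p Y, PrefFirst p (move p Y i) Z)
    (h₂ : ∀ i : Moves p.opponent Z, PrefFirst p Y (move p.opponent Z i)) : Pref p Y Z := by
  intro W
  induction W using move_induction with
  | h W ih =>
    constructor
    · intro h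
      have h' := (winsSecond_iff _ _).1 h
      rw [winsSecond_iff]
      refine forall_move_add (P := fun A => A.WinsFirst p) |>.2 ⟨fun i => ?_, fun i => h₂ i W h⟩
      exact (ih _ i).2 ((forall_move_add (P := fun A => A.WinsFirst p) |>.1 h').1 i)
    · intro h
      rw [winsFirst_iff] at h
      rcases exists_move_add (P := fun A => A.WinsSecond p) |>.1 h with ⟨i, hi⟩ | ⟨i, hi⟩
      · rw [winsFirst_iff]
        exact exists_move_add (P := fun A => A.WinsSecond p) |>.2 (Or.inl ⟨i, (ih _ i).1 hi⟩)
      · exact h₁ i W hi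

theorem equal_of_forall_pref {Y Z : PGame.{u}} (h : ∀ p, Pref p Y Z) : Equal Y Z := by
  have h₁ : ∀ p W, (W + Y).WinsFirst p ↔ (W + Z).WinsFirst p := fun p W =>
    ⟨(h p W).2, by simpa only [Player.opponent_opponent] using ((h p.opponent).opponent W).2⟩
  have h₂ : ∀ p W, (W + Y).WinsSecond p ↔ (W + Z).WinsSecond p := fun p W =>
    ⟨(h p W).1, by simpa only [Player.opponent_opponent] using ((h p.opponent).opponent W).1⟩
  intro W _ o
  cases o <;> simp only [HasOutcome, h₁, h₂]

theorem IsShort.move {X : PGame.{u}} (hX : X.IsShort) (p : Player) (i : Moves p X) :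
    (move p X i).IsShort := by
  have hi : IsOption (PGame.move p X i) X := ⟨p, i, rfl⟩
  obtain ⟨⟨k, hk⟩, hfin⟩ := hX
  refine ⟨?_, fun Y hY => hfin Y (Relation.ReflTransGen.head hi hY)⟩
  cases k with
  | zero => exact absurd hi (hk _)
  | succ k => exact ⟨k, hk _ hi⟩

end PGame

-- Positions, relabelling and independent sets

namespace DigraphPlacement

open PGame

theorem mem_delete {V : Type u} {G : Digraph V} {S : Finset V} {v w : V} :
    w ∈ delete G S v ↔ w ∈ S ∧ w ≠ v ∧ ¬ G.Adj v w := by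
  simp [delete]

theorem forall_move_position {V : Type u} {G : Digraph V} {φ : V → Color} {S : Finset V}
    {p : Player} {P : PGame.{u} → Prop} :
    (∀ i : Moves p (position G φ S), P (move p (position G φ S) i)) ↔
      ∀ v ∈ S, φ v = p.color → P (position G φ (delete G S v)) := by
  rw [position]
  cases p <;> simp [Moves, move, Player.color]

theorem exists_move_position {V : Type u} {G : Digraph V} {φ : V → Color} {S : Finset V}
    {p : Player} {P : PGame.{u} → Prop} :
    (∃ i : Moves p (position G φ S), P (move p (position G φ S) i)) ↔
      ∃ v ∈ S, φ v = p.color ∧ P (position G φ (delete G S v)) := by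
  rw [position]
  cases p <;> simp [Moves, move, Player.color, and_assoc]

/-- Loops are irrelevant, since a chosen vertex is deleted anyway; hence only distinct vertices are
compared. -/
theorem delete_map {V V' : Type u} {G : Digraph V} {G' : Digraph V'} (f : V ↪ V')
    (hG : ∀ v w, v ≠ w → (G'.Adj (f v) (f w) ↔ G.Adj v w)) (S : Finset V) (v : V) :
    delete G' (S.map f) (f v) = (delete G S v).map f := by
  ext x
  simp only [mem_delete, Finset.mem_map]
  constructor
  · rintro ⟨⟨w, hw, rfl⟩, hne, hadj⟩
    have hne' : w ≠ v := fun h => hne (h ▸ rfl)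
    exact ⟨w, ⟨hw, hne', fun h => hadj ((hG _ _ hne'.symm).2 h)⟩, rfl⟩
  · rintro ⟨w, ⟨hw, hne, hadj⟩, rfl⟩
    exact ⟨⟨w, hw, rfl⟩, f.injective.ne hne, fun h => hadj ((hG _ _ hne.symm).1 h)⟩

theorem pref_position_map {V V' : Type u} {G : Digraph V} {G' : Digraph V'} {φ : V → Color}
    {φ' : V' → Color} (f : V ↪ V') (hG : ∀ v w, v ≠ w → (G'.Adj (f v) (f w) ↔ G.Adj v w))
    (hφ : ∀ v, φ' (f v) = φ v) (p : Player) (S : Finset V) :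
    Pref p (position G φ S) (position G' φ' (S.map f)) := by
  induction hn : S.card using Nat.strong_induction_on generalizing S with
  | _ n ih =>
    subst hn
    have ih' : ∀ v ∈ S, Pref p (position G φ (delete G S v))
        (position G' φ' (delete G' (S.map f) (f v))) := fun v hv => by
      rw [delete_map f hG]
      exact ih _ (card_delete_lt G hv) _ rfl
    refine Pref.of_moves ?_ ?_
    · refine forall_move_position (P := fun A => PrefFirst p A _) |>.2 fun v hv hc => ?_
      refine PrefFirst.of_move (exists_move_position (P := fun A => Pref p _ A) |>.2 ?_)
      exact ⟨f v, Finset.mem_map_of_mem f hv, (hφ v).trans hc, ih' v hv⟩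
    · refine forall_move_position (P := fun A => PrefFirst p _ A) |>.2 fun x hx hc => ?_
      obtain ⟨v, hv, rfl⟩ := Finset.mem_map.1 hx
      refine PrefFirst.of_move_opponent (exists_move_position (P := fun A => Pref p A _) |>.2 ?_)
      exact ⟨v, hv, (hφ v).symm.trans hc, ih' v hv⟩

/-- Sufficiently many independent vertices of the colour of `p` are as good for `p` as any game
of bounded length. -/
theorem pref_position_of_independent {V : Type u} {G : Digraph V} {φ : V → Color} {p : Player}
    {k : ℕ} {X : PGame.{u}} (hX : EndsWithin k X) {S : Finset V} (hk : k ≤ S.card)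
    (hφ : ∀ v ∈ S, φ v = p.color) (hG : ∀ v ∈ S, ∀ w ∈ S, ¬ G.Adj v w) :
    Pref p X (position G φ S) := by
  classical
  induction k generalizing X S with
  | zero =>
    refine Pref.of_moves (fun i => absurd ⟨p, i, rfl⟩ (hX _)) ?_
    refine forall_move_position (P := fun A => PrefFirst p _ A) |>.2 fun v hv hc => ?_
    exact absurd (Player.color_injective (hc.symm.trans (hφ v hv))) p.opponent_ne
  | succ k ih =>
    refine Pref.of_moves (fun i => ?_) ?_
    · obtain ⟨v, hv⟩ : S.Nonempty := Finset.card_pos.1 (by omega)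
      refine PrefFirst.of_move (exists_move_position (P := fun A => Pref p _ A) |>.2 ?_)
      refine ⟨v, hv, hφ v hv, ?_⟩
      have hdel : delete G S v = S.erase v := by
        ext w
        rw [mem_delete, Finset.mem_erase]
        exact ⟨fun h => ⟨h.2.1, h.1⟩, fun h => ⟨h.2, h.1, hG v hv w h.2⟩⟩
      rw [hdel]
      refine ih (hX _ ⟨p, i, rfl⟩) ?_ (fun w hw => hφ w (Finset.mem_of_mem_erase hw))
        fun w hw x hx => hG w (Finset.mem_of_mem_erase hw) x (Finset.mem_of_mem_erase hx)
      rw [Finset.card_erase_of_mem hv]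
      omega
    · refine forall_move_position (P := fun A => PrefFirst p _ A) |>.2 fun v hv hc => ?_
      exact absurd (Player.color_injective (hc.symm.trans (hφ v hv))) p.opponent_ne

-- The digraph with keys and guards

/-- The vertices of the digraph that realizes a game with options indexed by `O`, where the option
`o` is realized on `W o`. Choosing `key o` leaves exactly the copy of `W o`. The guards make every
other first move a losing one; they come in four classes of `n` vertices each. -/
inductive Vertex (O : Type u) (W : O → Type u) (n : ℕ) : Type u
  | inner (o : O) (w : W o) : Vertex O W n
  | key (o : O) : Vertex O W n
  | guard (p : Player) (b : Bool) (m : Fin n) : Vertex O W n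

namespace Vertex

variable {O : Type u} {W : O → Type u} {n : ℕ}

theorem finite [Finite O] [∀ o, Finite (W o)] : Finite (Vertex O W n) := by
  refine Finite.of_surjective (Sum.elim (fun x : Σ o, W o => inner x.1 x.2)
    (Sum.elim key fun x : Player × Bool × Fin n => guard x.1 x.2.1 x.2.2)) ?_
  rintro (⟨o, w⟩ | o | ⟨p, b, m⟩)
  · exact ⟨Sum.inl ⟨o, w⟩, rfl⟩
  · exact ⟨Sum.inr (Sum.inl o), rfl⟩
  · exact ⟨Sum.inr (Sum.inr (p, b, m)), rfl⟩

/-- The class of guards of the opponent that survives the choice of a guard of `p` in class `b`. -/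
def next : Player → Bool → Bool
  | .left, b => b
  | .right, b => !b

/-- `Keeps G φ x y`: the vertex `y` survives the choice of the vertex `x ≠ y`. -/
def Keeps (G : ∀ o, Digraph (W o)) (φ : ∀ o, W o → Color) : Vertex O W n → Vertex O W n → Prop
  | inner o w, inner o' w' => ∃ h : o' = o, ¬ (G o).Adj w (h ▸ w')
  | inner o w, guard p b _ => φ o w = p.opponent.color ∧ b = true
  | key o, inner o' _ => o' = o
  | guard p b _, guard p' b' _ => p' = p ∧ b' = b ∨ p' = p.opponent ∧ b' = next p b
  | _, _ => False

/-- The digraph that realizes a game whose options are realized by the digraphs `G o`. -/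
def digraph (G : ∀ o, Digraph (W o)) (φ : ∀ o, W o → Color) : Digraph (Vertex O W n) where
  Adj x y := x ≠ y ∧ ¬ Keeps G φ x y

/-- The colouring that realizes a game in which `o` is an option of the player `owner o`. -/
def coloring (φ : ∀ o, W o → Color) (owner : O → Player) : Vertex O W n → Color
  | inner o w => φ o w
  | key o => (owner o).color
  | guard p _ _ => p.color

theorem mem_delete_digraph {G : ∀ o, Digraph (W o)} {φ : ∀ o, W o → Color}
    {S : Finset (Vertex O W n)} {x y : Vertex O W n} :
    y ∈ delete (digraph G φ) S x ↔ y ∈ S ∧ y ≠ x ∧ Keeps G φ x y := by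
  rw [mem_delete]
  simp only [digraph, not_and, not_not]
  exact ⟨fun h => ⟨h.1, h.2.1, h.2.2 h.2.1.symm⟩, fun h => ⟨h.1, h.2.1, fun _ => h.2.2⟩⟩

/-- The copy of `W o` in the vertex set. -/
def innerEmbedding (o : O) : W o ↪ Vertex O W n where
  toFun := inner o
  inj' _ _ h := by simpa using h

/-- A class of guards. -/
def guardEmbedding (p : Player) (b : Bool) : Fin n ↪ Vertex O W n where
  toFun := guard p b
  inj' _ _ h := by simpa using h

variable {G : ∀ o, Digraph (W o)} {φ : ∀ o, W o → Color}
  {owner : O → Player}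

theorem pref_position_delete_key [Fintype (Vertex O W n)] (o : O) [Fintype (W o)] (p : Player) :
    Pref p (game (G o) (φ o)) (position (digraph G φ) (coloring (n := n) φ owner)
      (delete (digraph G φ) Finset.univ (key o))) := by
  have hdel : delete (digraph G φ) Finset.univ (key o) =
      Finset.univ.map (innerEmbedding (n := n) o) := by
    ext x
    rw [mem_delete_digraph]
    rcases x with ⟨o', w⟩ | o' | ⟨q, b, m⟩
    · simp only [Keeps, Finset.mem_univ, Finset.mem_map, true_and, ne_eq, reduceCtorEq,
        not_false_eq_true]
      constructor
      · rintro rfl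
        exact ⟨w, rfl⟩
      · rintro ⟨_, h⟩
        exact (inner.inj h).1.symm
    · simp [Keeps, innerEmbedding]
    · simp [Keeps, innerEmbedding]
  rw [hdel, game]
  refine pref_position_map _ (fun v w hvw => ?_) (fun _ => by rfl) p _
  change (inner o v ≠ inner o w ∧ ¬ ∃ h : o = o, ¬ (G o).Adj v (h ▸ w)) ↔ _
  simp [hvw]

/-- If a class of guards of `p` is left, and no guard of the opponent that would survive them, then
`p` to move has a winning answer: a guard of that class. -/
theorem prefFirst_of_guards {k : ℕ} {X : PGame.{u}} (hX : EndsWithin k X) (hn : k < n)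
    {p : Player} {b : Bool} {S : Finset (Vertex O W n)} (hS : ∀ m, guard p b m ∈ S)
    (hS' : ∀ m, guard p.opponent (next p b) m ∉ S) :
    PrefFirst p X (position (digraph G φ) (coloring φ owner) S) := by
  classical
  refine PrefFirst.of_move (exists_move_position (P := fun A => Pref p _ A) |>.2 ?_)
  refine ⟨guard p b ⟨0, by omega⟩, hS _, rfl, ?_⟩
  have hmem : ∀ x ∈ delete (digraph G φ) S (guard p b ⟨0, by omega⟩), ∃ m, x = guard p b m := by
    intro x hx
    rw [mem_delete_digraph] at hx
    rcases x with ⟨o', w⟩ | o' | ⟨q, c, m⟩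
    · exact hx.2.2.elim
    · exact hx.2.2.elim
    -- Of the two classes that the guard spares, the opposing one is already gone.
    · rcases hx.2.2 with ⟨rfl, rfl⟩ | ⟨rfl, rfl⟩
      · exact ⟨m, rfl⟩
      · exact absurd hx.1 (hS' m)
  refine pref_position_of_independent hX ?_ ?_ ?_
  · have hsub : (Finset.univ.erase (⟨0, by omega⟩ : Fin n)).map (guardEmbedding p b) ⊆
        delete (digraph G φ) S (guard p b ⟨0, by omega⟩) := by
      intro x hx
      obtain ⟨m, hm, rfl⟩ := Finset.mem_map.1 hx
      rw [mem_delete_digraph]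
      refine ⟨hS m, ?_, Or.inl ⟨rfl, rfl⟩⟩
      exact (guardEmbedding p b).injective.ne (Finset.ne_of_mem_erase hm)
    refine le_trans ?_ (Finset.card_le_card hsub)
    rw [Finset.card_map, Finset.card_erase_of_mem (Finset.mem_univ _), Finset.card_univ,
      Fintype.card_fin]
    omega
  · intro x hx
    obtain ⟨m, rfl⟩ := hmem x hx
    rfl
  · intro x hx y hy
    obtain ⟨m, rfl⟩ := hmem x hx
    obtain ⟨m', rfl⟩ := hmem y hy
    exact fun h => h.2 (Or.inl ⟨rfl, rfl⟩)

theorem prefFirst_delete_inner [Fintype (Vertex O W n)] {k : ℕ} {X : PGame.{u}}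
    (hX : EndsWithin k X) (hn : k < n) {p : Player} {o : O} {w : W o}
    (hw : φ o w = p.opponent.color) :
    PrefFirst p X (position (digraph G φ) (coloring (n := n) φ owner)
      (delete (digraph G φ) Finset.univ (inner o w))) := by
  refine prefFirst_of_guards hX hn (b := true) (fun m => ?_) (fun m => ?_)
  · simp [mem_delete_digraph, Keeps, hw]
  · simp [mem_delete_digraph, Keeps, hw, Player.color_injective.eq_iff,
      p.opponent.opponent_ne.symm]

/-- The answer lies in the next class of the cycle. As the cycle has length four, the class after
that is not the one first played in, and so is already deleted. -/
theorem prefFirst_delete_guard [Fintype (Vertex O W n)] {k : ℕ} {X : PGame.{u}}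
    (hX : EndsWithin k X) (hn : k < n) (p : Player) (b : Bool) (m : Fin n) :
    PrefFirst p X (position (digraph G φ) (coloring φ owner)
      (delete (digraph (O := O) G φ) Finset.univ (guard p.opponent b m))) := by
  refine prefFirst_of_guards hX hn (b := next p.opponent b) (fun m => ?_) (fun m => ?_)
  · simp [mem_delete_digraph, Keeps, Player.opponent_opponent, p.opponent_ne.symm]
  · rw [mem_delete_digraph]
    cases p <;> cases b <;> simp [Keeps, next, Player.opponent]

end Vertex

theorem exists_forall_pref_game (X : PGame.{u}) (hX : X.IsShort) :
    ∃ (V : Type u) (_ : Fintype V) (G : Digraph V) (φ : V → Color),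
      (∀ v : V, ¬ G.Adj v v) ∧ ∀ p, Pref p X (game G φ) := by
  induction X using PGame.move_induction with
  | h X ih =>
    have hfin : ∀ p, Finite (Moves p X) := hX.2 X Relation.ReflTransGen.refl
    choose W hW G φ _ hpref using fun o : (p : Player) × Moves p X =>
      ih o.1 o.2 (hX.move o.1 o.2)
    obtain ⟨k, hk⟩ := hX.1
    -- One guard of a class is spent on the answer; `k` must remain.
    have : Finite (Vertex _ W (k + 1)) := Vertex.finite
    have := Fintype.ofFinite (Vertex _ W (k + 1))
    refine ⟨Vertex _ W (k + 1), this, Vertex.digraph G φ, Vertex.coloring φ Sigma.fst,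
      fun v h => h.1 rfl, fun p => Pref.of_moves (fun i => ?_) ?_⟩
    · refine PrefFirst.of_move (exists_move_position (P := fun A => Pref p _ A) |>.2 ?_)
      exact ⟨.key ⟨p, i⟩, Finset.mem_univ _, rfl,
        (hpref ⟨p, i⟩ p).trans (Vertex.pref_position_delete_key _ p)⟩
    · refine forall_move_position (P := fun A => PrefFirst p _ A) |>.2 fun x _ hc => ?_
      rcases x with ⟨o, w⟩ | ⟨q, i⟩ | ⟨q, b, m⟩
      · exact Vertex.prefFirst_delete_inner hk k.lt_succ_self hc
      · obtain rfl := Player.color_injective hc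
        exact PrefFirst.of_move_opponent
          ⟨i, (hpref ⟨_, i⟩ p).trans (Vertex.pref_position_delete_key _ p)⟩
      · obtain rfl := Player.color_injective hc
        exact Vertex.prefFirst_delete_guard hk k.lt_succ_self p b m

end DigraphPlacement

theorem mainTheorem1 (X : PGame.{u}) (hX : X.IsShort) :
    ∃ (V : Type u) (_ : Fintype V) (G : Digraph V) (φ : V → Color),
      (∀ v : V, ¬ G.Adj v v) ∧ PGame.Equal (DigraphPlacement.game G φ) X := by
  obtain ⟨V, hV, G, φ, hG, h⟩ := DigraphPlacement.exists_forall_pref_game X hX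
  refine ⟨V, hV, G, φ, hG, PGame.equal_of_forall_pref fun p => ?_⟩
  -- The bound for the opponent, reversed, is the missing inequality for `p`.
  simpa only [Player.opponent_opponent] using (h p.opponent).opponent
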